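/- Fix integers $\bar D,\bar B\ge 0$, a real processing cost $c$, a penalty function $F:\mathbb N\to\mathbb R$, a discount factor $\beta\in(0,1)$, and a probability distribution $Q$ on the finite set of states $S=\{(D,B): 0\le D\le\bar D,\ 0\le B\le\bar B\}$. The deadline-scheduling arm has state $s[t]=(D[t],B[t])\in S$ (time to deadline and remaining job size) and action $a[t]\in\{0,1\}$ (passive/active). Its reward is $$r[t]=\begin{cases}(1-c)\,a[t] & \text{if } B[t]>0,\ D[t]>1,\\ (1-c)\,a[t]-F(B[t]-a[t]) & \text{if } B[t]>0,\ D[t]=1,\\ 0&\text{otherwise,}\end{cases}$$ and its next state is $s[t+1]=(D[t]-1,\max(B[t]-a[t],0))$ if $D[t]>1$, while if $D[t]\le 1$ then $s[t+1]$ is drawn from $Q$, independently of the past. For an activation cost $\lambda\in\mathbb R$, an activation policy chooses $a[t]$ as a function of $s[0],\dots,s[t]$; it is optimal if it maximizes $\mathbb E\left[\sum_{t\ge 0}\beta^t(r[t]-\lambda a[t])\right]$ from every initial state. Let $Q_{\lambda,act}(s)$ (respectively $Q_{\lambda,pass}(s)$) be the expected discounted net reward obtained from the initial state $s$ by activating (respectively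 not activating) the arm in the first round and using an optimal policy for $\lambda$ from the second round on, and put $D_s(\lambda)=Q_{\lambda,act}(s)-Q_{\lambda,pass}(s)$. Then the arm is strongly indexable: for every $\lambda$ an optimal policy exists, and for every state $s\in S$ (and every choice of optimal policies) the function $\lambda\mapsto D_s(\lambda)$ is strictly decreasing on $\mathbb R$. -/

import Mathlib

open MeasureTheory ProbabilityTheory

/-- A restless arm with state space `S`. The action `true` is "active", `false` is "passive".
`trans s a` is the law of the next state and `reward s a` the reward collected in a round that is
spent in state `s` with action `a`. -/
structure RestlessArm (S : Type*) where
  trans : S → Bool → PMF S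
  reward : S → Bool → ℝ

/-- An activation policy: in round `n` it sees the states of the rounds `0, …, n` and decides
whether the arm is activated. (Past actions are functions of the past states.) -/
abbrev ActivationPolicy (S : Type*) := (n : ℕ) → (Finset.Iic n → S) → Bool

namespace RestlessArm

noncomputable section

/-- `1` if the arm is active, `0` if it is passive. -/
def act (a : Bool) : ℝ := if a then 1 else 0

variable {S : Type*} [Finite S] [MeasurableSpace S] [MeasurableSingletonClass S]

/-- The law of the state of round `n + 1` given the states of the rounds `0, …, n`, when the policy
`π` is used. -/
def stepKernel (arm : RestlessArm S) (π : ActivationPolicy S) (n : ℕ) :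
    Kernel (Finset.Iic n → S) S :=
  Kernel.ofFunOfCountable fun h =>
    (arm.trans (h ⟨n, Finset.mem_Iic.2 le_rfl⟩) (π n h)).toMeasure

instance (arm : RestlessArm S) (π : ActivationPolicy S) (n : ℕ) :
    IsMarkovKernel (arm.stepKernel π n) :=
  ⟨fun h => PMF.toMeasure.isProbabilityMeasure
    (arm.trans (h ⟨n, Finset.mem_Iic.2 le_rfl⟩) (π n h))⟩

/-- The law (given by the Ionescu-Tulcea theorem) of the state process `(s[0], s[1], …)` started
in `s` under the policy `π`. -/
def law (arm : RestlessArm S) (π : ActivationPolicy S) (s : S) : Measure (ℕ → S) :=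
  Kernel.traj (X := fun _ => S) (arm.stepKernel π) 0 fun _ => s

/-- The action `a[t]` that `π` takes in round `t` along the trajectory `ω`. -/
def action (π : ActivationPolicy S) (ω : ℕ → S) (t : ℕ) : Bool :=
  π t fun i => ω i

/-- The expected discounted net reward `𝔼[∑ₜ βᵗ (r[t] - lam * a[t])]` of the policy `π` from the
initial state `s`, with activation cost `lam`. -/
def netReward (arm : RestlessArm S) (β lam : ℝ) (π : ActivationPolicy S) (s : S) : ℝ :=
  ∫ ω, ∑' t : ℕ, β ^ t * (arm.reward (ω t) (action π ω t) - lam * act (action π ω t))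
    ∂(arm.law π s)

/-- `π` maximizes the expected discounted net reward, from every initial state. -/
def IsOptimal (arm : RestlessArm S) (β lam : ℝ) (π : ActivationPolicy S) : Prop :=
  ∀ (π' : ActivationPolicy S) (s : S), arm.netReward β lam π' s ≤ arm.netReward β lam π s

/-- The expected discounted net reward of taking the action `a` in the first round, in state `s`,
and running the policy `π` from the second round on. -/
def firstThen (arm : RestlessArm S) (β lam : ℝ) (a : Bool) (π : ActivationPolicy S) (s : S) : ℝ :=
  arm.reward s a - lam * act a
    + β * ∫ s', arm.netReward β lam π s' ∂(arm.trans s a).toMeasure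

/-- The arm is strongly indexable: for every activation cost `lam` there is an optimal policy, and
the advantage of activating over not activating in the first round, both followed by an optimal
policy for `lam`, is strictly decreasing in `lam`, for every state `s`.
(This advantage does not depend on which optimal policies are taken; the definition asks for the
monotonicity for all choices.) -/
def StronglyIndexable (arm : RestlessArm S) (β : ℝ) : Prop :=
  (∀ lam : ℝ, ∃ π, arm.IsOptimal β lam π) ∧
    ∀ π : ℝ → ActivationPolicy S, (∀ lam, arm.IsOptimal β lam (π lam)) →
      ∀ s : S, StrictAnti fun lam : ℝ =>
        arm.firstThen β lam true (π lam) s - arm.firstThen β lam false (π lam) s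

end

end RestlessArm

/-- States `(D, B)` of a charging spot: `D ≤ Dmax` is the time until the deadline, `B ≤ Bmax` the
remaining job size. -/
abbrev DeadlineState (Dmax Bmax : ℕ) := Fin (Dmax + 1) × Fin (Bmax + 1)

/-- The state `(D - 1, (B - a)⁺)`. -/
def DeadlineState.next {Dmax Bmax : ℕ} (s : DeadlineState Dmax Bmax) (a : Bool) :
    DeadlineState Dmax Bmax :=
  (⟨s.1.val - 1, by omega⟩, ⟨s.2.val - a.toNat, by omega⟩)

/-- The arm of the deadline scheduling problem with processing cost `c`, penalty function `F` and
arrival law `Q`. -/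
noncomputable def deadlineArm (Dmax Bmax : ℕ) (c : ℝ) (F : ℕ → ℝ)
    (Q : PMF (DeadlineState Dmax Bmax)) : RestlessArm (DeadlineState Dmax Bmax) where
  trans s a := if 1 < s.1.val then PMF.pure (s.next a) else Q
  reward s a :=
    if 0 < s.2.val ∧ 1 < s.1.val then (1 - c) * RestlessArm.act a
    else if 0 < s.2.val ∧ s.1.val = 1 then
      (1 - c) * RestlessArm.act a - F (s.2.val - a.toNat)
    else 0

/-! For any optimal policies, `firstThen` is the one-round lookahead of a Bellman solution, so
everything reduces to how that solution `V` depends on the activation cost. If `D ≤ 1` or `B = 0`,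
the action does not affect the law of the next state, and the advantage is a constant minus the
cost. Otherwise it is `1 - c - lam + β * (V (D-1, B-1) - V (D-1, B))`. By induction on `D`
(`sub_sub_le_of_isBellman`), the bracket grows with slope at most `1` in the cost, so `β < 1` makes
the advantage strictly decreasing. -/

namespace RestlessArm

/-! ### Discounted optimality: Bellman solutions and history-dependent policies. -/

section Verification

variable {S : Type*} [MeasurableSpace S]

/-- The one-round lookahead value: the net reward of a round spent in `s` with action `a`, plus the
discounted expectation of `V` at the next state. -/
noncomputable def lookahead (arm : RestlessArm S) (β lam : ℝ) (V : S → ℝ) (s : S) (a : Bool) : ℝ :=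
  arm.reward s a - lam * act a + β * ∫ s', V s' ∂(arm.trans s a).toMeasure

/-- `V` solves the Bellman optimality equation. -/
def IsBellman (arm : RestlessArm S) (β lam : ℝ) (V : S → ℝ) : Prop :=
  ∀ s, V s = max (arm.lookahead β lam V s true) (arm.lookahead β lam V s false)

variable [Finite S] [MeasurableSingletonClass S]

instance (arm : RestlessArm S) (π : ActivationPolicy S) (s : S) :
    IsProbabilityMeasure (arm.law π s) := by
  unfold law; infer_instance

lemma integrable_history (arm : RestlessArm S) (π : ActivationPolicy S) (s : S) (n : ℕ)
    (g : (Finset.Iic n → S) → ℝ) :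
    Integrable (fun ω : ℕ → S => g fun i => ω i) (arm.law π s) :=
  Integrable.comp_measurable (f := fun ω : ℕ → S => fun i : Finset.Iic n => ω i) .of_finite
    (by fun_prop)

lemma integrable_state_action (arm : RestlessArm S) (π : ActivationPolicy S) (s : S) (n : ℕ)
    (g : S → Bool → ℝ) :
    Integrable (fun ω : ℕ → S => g (ω n) (action π ω n)) (arm.law π s) :=
  arm.integrable_history π s n fun h => g (h ⟨n, Finset.mem_Iic.2 le_rfl⟩) (π n h)

lemma integral_law_zero (arm : RestlessArm S) (π : ActivationPolicy S) (s : S) (V : S → ℝ) :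
    ∫ ω, V (ω 0) ∂(arm.law π s) = V s := by
  have h := Kernel.traj_map_frestrictLe_apply (X := fun _ => S) (κ := arm.stepKernel π) 0 0
    fun _ => s
  rw [Kernel.partialTraj_self, Kernel.id_apply] at h
  have h2 := integral_map (μ := arm.law π s)
    (Preorder.measurable_frestrictLe (X := fun _ : ℕ => S) 0).aemeasurable
    (f := fun h => V (h ⟨0, Finset.mem_Iic.2 le_rfl⟩)) AEStronglyMeasurable.of_discrete
  rw [law, h, integral_dirac] at h2
  exact h2.symm

/-- The Markov property: the state of round `n + 1` has law `trans` given the history. -/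
lemma integral_law_succ (arm : RestlessArm S) (π : ActivationPolicy S) (s : S) (V : S → ℝ)
    (n : ℕ) :
    ∫ ω, V (ω (n + 1)) ∂(arm.law π s) =
      ∫ ω, ∫ s', V s' ∂(arm.trans (ω n) (action π ω n)).toMeasure ∂(arm.law π s) := by
  have h := Kernel.partialTraj_compProd_eq_map_traj (X := fun _ => S) (κ := arm.stepKernel π)
    (Nat.zero_le n) (x₀ := fun _ => s)
  have h1 : ∫ x, V x.2 ∂((arm.law π s).map
      fun x => (Preorder.frestrictLe (π := fun _ : ℕ => S) n x, x (n + 1))) =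
      ∫ ω, V (ω (n + 1)) ∂(arm.law π s) :=
    integral_map (by fun_prop) AEStronglyMeasurable.of_discrete
  rw [← h1, law, ← h, Measure.integral_compProd .of_finite,
    ← Kernel.traj_map_frestrictLe_apply,
    integral_map (by fun_prop) AEStronglyMeasurable.of_discrete]
  rfl

/-- The shortfall of a policy from any `V : S → ℝ` is the discounted sum of its expected
one-round losses measured against `V`. -/
lemma hasSum_sub_netReward (arm : RestlessArm S) {β : ℝ} (hβ0 : 0 ≤ β) (hβ1 : β < 1) (lam : ℝ)
    (V : S → ℝ) (π : ActivationPolicy S) (s : S) :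
    HasSum (fun t : ℕ => β ^ t *
        ∫ ω, (V (ω t) - arm.lookahead β lam V (ω t) (action π ω t)) ∂(arm.law π s))
      (V s - arm.netReward β lam π s) := by
  have hgeo (C : ℝ) : Summable fun t : ℕ => β ^ t * C :=
    (summable_geometric_of_lt_one hβ0 hβ1).mul_right C
  obtain ⟨C, hC⟩ : ∃ C, ∀ p : S × Bool, ‖arm.reward p.1 p.2 - lam * act p.2‖ ≤ C :=
    (Set.finite_range _).bddAbove.imp fun C h p => h ⟨p, rfl⟩
  obtain ⟨B, hB⟩ : ∃ B, ∀ x, ‖V x‖ ≤ B :=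
    (Set.finite_range _).bddAbove.imp fun C h p => h ⟨p, rfl⟩
  have hbound {f : (ℕ → S) → ℝ} {C : ℝ} (h : ∀ ω, ‖f ω‖ ≤ C) :
      ‖∫ ω, f ω ∂(arm.law π s)‖ ≤ C := by
    simpa using norm_integral_le_of_norm_le_const (μ := arm.law π s) (.of_forall h)
  have hr : HasSum (fun t : ℕ => β ^ t * ∫ ω, (arm.reward (ω t) (action π ω t) -
      lam * act (action π ω t)) ∂(arm.law π s)) (arm.netReward β lam π s) := by
    simp_rw [← integral_const_mul]
    refine hasSum_integral_of_summable_integral_norm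
      (fun t => (arm.integrable_state_action π s t
        fun x a => arm.reward x a - lam * act a).const_mul _) ?_
    refine (hgeo C).of_nonneg_of_le (fun t => integral_nonneg fun _ => norm_nonneg _) fun t => ?_
    refine (le_abs_self _).trans (hbound fun ω => ?_)
    rw [norm_norm, norm_mul, Real.norm_of_nonneg (pow_nonneg hβ0 t)]
    exact mul_le_mul_of_nonneg_left (hC (_, _)) (pow_nonneg hβ0 t)
  have hV : Summable fun t : ℕ => β ^ t * ∫ ω, V (ω t) ∂(arm.law π s) := by
    refine (hgeo B).of_norm_bounded fun t => ?_
    rw [norm_mul, Real.norm_of_nonneg (pow_nonneg hβ0 t)]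
    exact mul_le_mul_of_nonneg_left (hbound fun ω => hB _) (pow_nonneg hβ0 t)
  -- The series minus its own shift by one leaves only the term of round `0`, which is `V s`.
  have htel := hV.hasSum.sub ((hasSum_nat_add_iff' 1).2 hV.hasSum)
  simp only [Finset.sum_range_one, pow_zero, one_mul, integral_law_zero, sub_sub_cancel] at htel
  refine (htel.sub hr).congr_fun fun t => ?_
  have hi := arm.integrable_state_action π s t
  have hi₁ := hi fun x a => arm.reward x a - lam * act a
  have hi₂ := hi fun x a => β * ∫ s', V s' ∂(arm.trans x a).toMeasure
  rw [integral_law_succ, integral_sub (hi fun x _ => V x) (hi (arm.lookahead β lam V))]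
  simp only [lookahead]
  rw [integral_add hi₁ hi₂,
    integral_const_mul]
  ring

lemma IsBellman.netReward_le {arm : RestlessArm S} {β lam : ℝ} (hβ0 : 0 ≤ β) (hβ1 : β < 1)
    {V : S → ℝ} (hV : arm.IsBellman β lam V) (π : ActivationPolicy S) (s : S) :
    arm.netReward β lam π s ≤ V s := by
  refine sub_nonneg.1 ((arm.hasSum_sub_netReward hβ0 hβ1 lam V π s).nonneg fun t => ?_)
  refine mul_nonneg (pow_nonneg hβ0 t) (integral_nonneg fun ω => sub_nonneg.2 ?_)
  rw [hV (ω t)]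
  cases action π ω t
  exacts [le_max_right _ _, le_max_left _ _]

/-- The stationary policy that is greedy for `V` has zero loss in every round. -/
lemma IsBellman.exists_netReward_eq {arm : RestlessArm S} {β lam : ℝ} (hβ0 : 0 ≤ β) (hβ1 : β < 1)
    {V : S → ℝ} (hV : arm.IsBellman β lam V) :
    ∃ π : ActivationPolicy S, ∀ s, arm.netReward β lam π s = V s := by
  have h (s : S) : ∃ a, V s = arm.lookahead β lam V s a := by
    rw [hV s]
    exact (max_choice _ _).elim (fun h => ⟨_, h⟩) fun h => ⟨_, h⟩
  choose a ha using h
  refine ⟨fun n h => a (h ⟨n, Finset.mem_Iic.2 le_rfl⟩), fun s => ?_⟩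
  have hs := arm.hasSum_sub_netReward hβ0 hβ1 lam V
    (fun n h => a (h ⟨n, Finset.mem_Iic.2 le_rfl⟩)) s
  simp only [action, ← ha, sub_self, integral_zero, mul_zero] at hs
  exact (sub_eq_zero.1 (hs.unique hasSum_zero)).symm

/-- The Bellman operator is a `β`-contraction in the sup norm, so Banach's fixed point theorem
applies. -/
lemma exists_isBellman (arm : RestlessArm S) {β : ℝ} (hβ0 : 0 ≤ β) (hβ1 : β < 1) (lam : ℝ) :
    ∃ V, arm.IsBellman β lam V := by
  have := Fintype.ofFinite S
  let T : (S → ℝ) → S → ℝ := fun V s =>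
    max (arm.lookahead β lam V s true) (arm.lookahead β lam V s false)
  have hl (V W : S → ℝ) (s : S) (a : Bool) :
      |arm.lookahead β lam V s a - arm.lookahead β lam W s a| ≤ β * dist V W := by
    have : arm.lookahead β lam V s a - arm.lookahead β lam W s a =
        β * ∫ s', (V s' - W s') ∂(arm.trans s a).toMeasure := by
      rw [integral_sub .of_finite .of_finite, lookahead, lookahead]
      ring
    rw [this, abs_mul, abs_of_nonneg hβ0]
    refine mul_le_mul_of_nonneg_left ?_ hβ0
    simpa using norm_integral_le_of_norm_le_const (μ := (arm.trans s a).toMeasure)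
      (f := fun s' => V s' - W s') (.of_forall fun x => dist_le_pi_dist V W x)
  have hT : ContractingWith ⟨β, hβ0⟩ T := by
    refine ⟨hβ1, LipschitzWith.of_dist_le_mul fun V W => ?_⟩
    refine (dist_pi_le_iff (mul_nonneg hβ0 dist_nonneg)).2 fun s => ?_
    exact (abs_max_sub_max_le_max _ _ _ _).trans (max_le (hl V W s true) (hl V W s false))
  exact ⟨ContractingWith.fixedPoint T hT, fun s => (congrFun hT.fixedPoint_isFixedPt s).symm⟩

lemma exists_isOptimal (arm : RestlessArm S) {β : ℝ} (hβ0 : 0 ≤ β) (hβ1 : β < 1) (lam : ℝ) :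
    ∃ π, arm.IsOptimal β lam π := by
  obtain ⟨V, hV⟩ := arm.exists_isBellman hβ0 hβ1 lam
  obtain ⟨π, hπ⟩ := hV.exists_netReward_eq hβ0 hβ1
  exact ⟨π, fun π' s => (hV.netReward_le hβ0 hβ1 π' s).trans_eq (hπ s).symm⟩

lemma IsOptimal.isBellman {arm : RestlessArm S} {β lam : ℝ} (hβ0 : 0 ≤ β) (hβ1 : β < 1)
    {π : ActivationPolicy S} (hπ : arm.IsOptimal β lam π) :
    arm.IsBellman β lam (arm.netReward β lam π) := by
  obtain ⟨V, hV⟩ := arm.exists_isBellman hβ0 hβ1 lam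
  obtain ⟨π', hπ'⟩ := hV.exists_netReward_eq hβ0 hβ1
  have h : arm.netReward β lam π = V := funext fun s =>
    (hV.netReward_le hβ0 hβ1 π s).antisymm ((hπ' s).symm.trans_le (hπ π' s))
  rwa [h]

end Verification

end RestlessArm

/-- Here `x`, `y`, `z` are continuation values for successively smaller remaining jobs. Fix the
maximizing actions in the two terms with positive sign, and bound the other two maxima below by the
same pair of actions, exchanged between the two terms if they differ. -/
lemma max_sub_max_sub_le {l l' m x y z x' y' z' : ℝ}
    (hyx : (y' - x') - (y - x) ≤ l' - l) (hzy : (z' - y') - (z - y) ≤ l' - l) :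
    (max (m - l' + z') y' - max (m - l' + y') x') - (max (m - l + z) y - max (m - l + y) x)
      ≤ l' - l := by
  rcases max_cases (m - l' + z') y' with h1 | h1 <;> rcases max_cases (m - l + y) x with h2 | h2 <;>
  linarith [le_max_left (m - l' + y') x', le_max_right (m - l' + y') x',
    le_max_left (m - l + z) y, le_max_right (m - l + z) y]

/-- The boundary case of an empty job: activation only costs, and both actions continue with `k`. -/
lemma max_sub_max_sub_le_of_idle {l l' m k x y k' x' y' : ℝ} (hl : l ≤ l')
    (hyx : (y' - x') - (y - x) ≤ l' - l) (hky : k' - y' = k - y) :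
    (max (-l' + k') k' - max (m - l' + y') x') - (max (-l + k) k - max (m - l + y) x)
      ≤ l' - l := by
  rcases max_cases (-l' + k') k' with h1 | h1 <;> rcases max_cases (m - l + y) x with h2 | h2 <;>
  linarith [le_max_left (m - l' + y') x', le_max_right (m - l' + y') x',
    le_max_left (-l + k) k, le_max_right (-l + k) k]

/-! ### The slope bound for the deadline arm. -/

section Deadline

open RestlessArm

variable {Dmax Bmax : ℕ} {c : ℝ} {F : ℕ → ℝ} {Q : PMF (DeadlineState Dmax Bmax)} {β l l' : ℝ}
  {V V' : DeadlineState Dmax Bmax → ℝ}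

lemma lookahead_deadlineArm_of_one_lt {s : DeadlineState Dmax Bmax} (hs : 1 < s.1.val) (a : Bool) :
    (deadlineArm Dmax Bmax c F Q).lookahead β l V s a =
      (if 0 < s.2.val then (1 - c) * act a else 0) - l * act a + β * V (s.next a) := by
  simp [lookahead, deadlineArm, hs, hs.ne', PMF.toMeasure_pure]

lemma lookahead_deadlineArm_of_le_one {s : DeadlineState Dmax Bmax} (hs : s.1.val ≤ 1) (a : Bool) :
    (deadlineArm Dmax Bmax c F Q).lookahead β l V s a =
      (deadlineArm Dmax Bmax c F Q).reward s a - l * act a + β * ∫ s', V s' ∂Q.toMeasure := by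
  simp [lookahead, deadlineArm, hs.not_gt]

/-- The gain in value from having one unit less to process grows at most with slope `1` in the
activation cost. -/
lemma sub_sub_le_of_isBellman (hβ0 : 0 ≤ β) (hβ1 : β ≤ 1) (hl : l ≤ l')
    (hV : (deadlineArm Dmax Bmax c F Q).IsBellman β l V)
    (hV' : (deadlineArm Dmax Bmax c F Q).IsBellman β l' V') (d : ℕ) (hd : d + 1 < Dmax + 1)
    (b : ℕ) (hb : b + 1 < Bmax + 1) :
    (V' (⟨d + 1, hd⟩, ⟨b, by omega⟩) - V' (⟨d + 1, hd⟩, ⟨b + 1, hb⟩)) -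
      (V (⟨d + 1, hd⟩, ⟨b, by omega⟩) - V (⟨d + 1, hd⟩, ⟨b + 1, hb⟩)) ≤ l' - l := by
  induction d generalizing b with
  | zero =>
    rw [hV' (_, ⟨b, _⟩), hV' (_, ⟨b + 1, _⟩), hV (_, ⟨b, _⟩), hV (_, ⟨b + 1, _⟩)]
    cases b with
    | zero =>
      -- An empty job incurs no penalty, whereas one just finished at the deadline pays `F 0`,
      -- possibly nonzero. So `k` and `y` differ, but by an offset independent of the cost.
      convert max_sub_max_sub_le_of_idle (l := l) (l' := l') (m := 1 - c)
        (k := β * ∫ s', V s' ∂Q.toMeasure) (k' := β * ∫ s', V' s' ∂Q.toMeasure)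
        (x := -F 1 + β * ∫ s', V s' ∂Q.toMeasure) (x' := -F 1 + β * ∫ s', V' s' ∂Q.toMeasure)
        (y := -F 0 + β * ∫ s', V s' ∂Q.toMeasure) (y' := -F 0 + β * ∫ s', V' s' ∂Q.toMeasure)
        hl (by linarith) (by ring) using 4
      all_goals
        rw [lookahead_deadlineArm_of_le_one (by simp)]
        simp [deadlineArm, act, -Fin.val_pos_iff]
        try ring_nf
    | succ b =>
      convert max_sub_max_sub_le (l := l) (l' := l') (m := 1 - c)
        (x := -F (b + 2) + β * ∫ s', V s' ∂Q.toMeasure)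
        (x' := -F (b + 2) + β * ∫ s', V' s' ∂Q.toMeasure)
        (y := -F (b + 1) + β * ∫ s', V s' ∂Q.toMeasure)
        (y' := -F (b + 1) + β * ∫ s', V' s' ∂Q.toMeasure)
        (z := -F b + β * ∫ s', V s' ∂Q.toMeasure)
        (z' := -F b + β * ∫ s', V' s' ∂Q.toMeasure)
        (by linarith) (by linarith) using 4
      all_goals
        rw [lookahead_deadlineArm_of_le_one (by simp)]
        simp [deadlineArm, act, -Fin.val_pos_iff]
        try ring_nf
  | succ d ih =>
    have ih' (b : ℕ) (hb : b + 1 < Bmax + 1) :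
        (β * V' (⟨d + 1, by omega⟩, ⟨b, by omega⟩) - β * V' (⟨d + 1, by omega⟩, ⟨b + 1, hb⟩)) -
          (β * V (⟨d + 1, by omega⟩, ⟨b, by omega⟩) - β * V (⟨d + 1, by omega⟩, ⟨b + 1, hb⟩))
          ≤ l' - l := by
      have := mul_le_mul_of_nonneg_left (ih (by omega) b hb) hβ0
      have := mul_le_of_le_one_left (sub_nonneg.2 hl) hβ1
      linarith
    rw [hV' (_, ⟨b, _⟩), hV' (_, ⟨b + 1, _⟩), hV (_, ⟨b, _⟩), hV (_, ⟨b + 1, _⟩)]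
    cases b with
    | zero =>
      convert max_sub_max_sub_le_of_idle (m := 1 - c) hl (ih' 0 hb)
        (k := β * V (⟨d + 1, by omega⟩, ⟨0, by omega⟩))
        (k' := β * V' (⟨d + 1, by omega⟩, ⟨0, by omega⟩)) (by ring) using 4
      all_goals
        rw [lookahead_deadlineArm_of_one_lt (by simp)]
        simp [act, DeadlineState.next]
    | succ b =>
      convert max_sub_max_sub_le (m := 1 - c) (ih' (b + 1) hb) (ih' b _) using 4
      all_goals
        rw [lookahead_deadlineArm_of_one_lt (by simp)]
        simp [act, DeadlineState.next]

lemma lookahead_sub_lt_of_isBellman (hβ0 : 0 ≤ β) (hβ1 : β < 1) (hl : l < l')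
    (hV : (deadlineArm Dmax Bmax c F Q).IsBellman β l V)
    (hV' : (deadlineArm Dmax Bmax c F Q).IsBellman β l' V') (s : DeadlineState Dmax Bmax) :
    (deadlineArm Dmax Bmax c F Q).lookahead β l' V' s true -
        (deadlineArm Dmax Bmax c F Q).lookahead β l' V' s false <
      (deadlineArm Dmax Bmax c F Q).lookahead β l V s true -
        (deadlineArm Dmax Bmax c F Q).lookahead β l V s false := by
  obtain hs | hs := le_or_gt s.1.val 1
  · simp only [lookahead_deadlineArm_of_le_one hs]
    simp [act]
    linarith
  · simp only [lookahead_deadlineArm_of_one_lt hs]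
    obtain ⟨⟨_ | _ | d, hd⟩, ⟨_ | b, hb⟩⟩ := s
    any_goals simp at hs
    -- With `B = 0`, truncated subtraction sends both actions to the same state.
    · simpa [act, DeadlineState.next] using hl
    · have h := mul_le_mul_of_nonneg_left
        (sub_sub_le_of_isBellman hβ0 hβ1.le hl.le hV hV' d (by omega) b hb) hβ0
      have := mul_lt_of_lt_one_left (sub_pos.2 hl) hβ1
      simp [act, DeadlineState.next]
      linarith

end Deadline

theorem theoremA1 (Dmax Bmax : ℕ) (c : ℝ) (F : ℕ → ℝ) (Q : PMF (DeadlineState Dmax Bmax))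
    (β : ℝ) (hβ0 : 0 < β) (hβ1 : β < 1) :
    (deadlineArm Dmax Bmax c F Q).StronglyIndexable β :=
  ⟨fun lam => RestlessArm.exists_isOptimal _ hβ0.le hβ1 lam, fun _ hπ s _ _ hl =>
    lookahead_sub_lt_of_isBellman hβ0.le hβ1 hl ((hπ _).isBellman hβ0.le hβ1)
      ((hπ _).isBellman hβ0.le hβ1) s⟩
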